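/- Let $K$ be a field complete with respect to a discrete valuation $v$ (real-valued, with $v(0)=\infty$), and let $p\ge 0$ be the characteristic of its residue field. Let $\ell\ge 2$ be an integer, $c\in K^\times$, $a\in K$ and $f(z)=z^\ell-c$. Fix an algebraic closure $\overline K$ of $K$. For $n\ge 0$ let $f^n$ be the $n$th iterate of $f$, let $f^{-n}(a)$ be the set of solutions of $f^n(z)=a$ in $\overline K$, and let $K_n=K(f^{-n}(a))\subseteq\overline K$; let $K_\infty=\bigcup_{n\ge 1}K_n$. For $n\ge 1$ let $$\nu_n=-\frac{\ell^{n+1}}{(\ell^n-1)(\ell-1)}\,v(\ell).$$ Suppose that $v(a)\ge v(c)/\ell$. (Tame case) If $p\nmid\ell$ and $v(c)<0$, then $K_\infty=K_1$. (Wild case) Suppose that $\ell=p$ and that $K$ is a finite extension of $\mathbb{Q}_p$, and let $n\ge 1$. If $v(c)<\nu_n$, then $K_\infty=K_n$. If $v(c)=\nu_n$, then $K_\infty=K_{n+1}$ and $K_{n+1}/K_n$ is unramified. -/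

import Mathlib

namespace LocalArboreal

open Polynomial

noncomputable section

/-- The ring of integers `{x : ‖x‖ ≤ 1}` of a nonarchimedean normed field `K`. -/
abbrev ringOfIntegers (K : Type*) [NormedField K] [IsUltrametricDist K] : ValuationSubring K :=
  (NormedField.valuation (K := K)).valuationSubring

/-- The residue field of a nonarchimedean normed field `K`. -/
abbrev residueField (K : Type*) [NormedField K] [IsUltrametricDist K] : Type _ :=
  IsLocalRing.ResidueField (ringOfIntegers K)

/-- The additive valuation `v x = -log ‖x‖` of a nonzero element `x` of `K`.
(The value `v 0 = ∞` is not represented: `0` has to be treated separately.) -/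
def v {K : Type*} [NormedField K] (x : K) : ℝ := -Real.log ‖x‖

/-- `ν_n = -ℓ^(n+1) / ((ℓ^n - 1) (ℓ - 1)) * v(ℓ)`, for `n ≥ 1` and `ℓ ≥ 2`.
Thus `ν_n` scales with `v`, and if `v` is normalized by `v(ℓ) = 1`
then `ν_n = -ℓ^(n+1) / ((ℓ^n - 1) (ℓ - 1))`. -/
def nu (K : Type*) [NormedField K] (ℓ n : ℕ) : ℝ :=
  -((ℓ : ℝ) ^ (n + 1) / (((ℓ : ℝ) ^ n - 1) * ((ℓ : ℝ) - 1))) * v (ℓ : K)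

/-- `K` is (abstractly) a finite extension of `ℚ_p`. -/
def IsFiniteExtensionOfPadic (p : ℕ) (K : Type*) [Field K] : Prop :=
  ∃ (_ : Fact p.Prime) (_ : Algebra ℚ_[p] K), FiniteDimensional ℚ_[p] K

/-- The set `f^{-n}(a)` of solutions in `L` to `f^n(z) = a`, where `f^n` is the `n`-th iterate. -/
def iterPreimage {K : Type*} [Field K] (L : Type*) [Field L] [Algebra K L]
    (f : K[X]) (a : K) (n : ℕ) : Set L :=
  {α : L | (fun z : L => aeval z f)^[n] α = algebraMap K L a}

/-- `K_n = K(f^{-n}(a))`. -/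
def level {K : Type*} [Field K] (L : Type*) [Field L] [Algebra K L]
    (f : K[X]) (a : K) (n : ℕ) : IntermediateField K L :=
  IntermediateField.adjoin K (iterPreimage L f a n)

/-- `K_∞`, the union of the increasing sequence of fields `K_n`, `n ≥ 1`. -/
def levelInfty {K : Type*} [Field K] (L : Type*) [Field L] [Algebra K L]
    (f : K[X]) (a : K) : IntermediateField K L :=
  ⨆ (n : ℕ) (_ : 1 ≤ n), level L f a n

/-- The ring of integers of an intermediate field `E` of an algebraic extension `L/K`,
with respect to the unique extension of the absolute value of `K` (complete) to `L`, which is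
the spectral norm. -/
def integersOf {K : Type*} [NontriviallyNormedField K] [IsUltrametricDist K]
    {L : Type*} [Field L] [Algebra K L] [Algebra.IsAlgebraic K L]
    (E : IntermediateField K L) : Subring L where
  carrier := {x : L | x ∈ E ∧ spectralNorm K L x ≤ 1}
  zero_mem' := ⟨E.zero_mem, by rw [spectralNorm_zero]; exact zero_le_one⟩
  one_mem' := ⟨E.one_mem, spectralNorm_one.le⟩
  add_mem' := fun {x y} hx hy => ⟨E.add_mem hx.1 hy.1,
    (isNonarchimedean_spectralNorm x y).trans (max_le hx.2 hy.2)⟩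
  neg_mem' := fun {x} hx => ⟨E.neg_mem hx.1, by
    rw [spectralNorm_neg (Algebra.IsAlgebraic.isAlgebraic x)]; exact hx.2⟩
  mul_mem' := fun {x y} hx hy => ⟨E.mul_mem hx.1 hy.1,
    (spectralNorm_mul (Algebra.IsAlgebraic.isAlgebraic x)
      (Algebra.IsAlgebraic.isAlgebraic y)).trans
      (mul_le_one₀ hx.2 (spectralNorm_nonneg y) hy.2)⟩

theorem integersOf_mono {K : Type*} [NontriviallyNormedField K] [IsUltrametricDist K]
    {L : Type*} [Field L] [Algebra K L] [Algebra.IsAlgebraic K L]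
    {E F : IntermediateField K L} (h : E ≤ F) : integersOf E ≤ integersOf F :=
  fun _ hx => ⟨h hx.1, hx.2⟩

/-- The extension `F/E` of intermediate fields of `L/K`, each finite over `K`, is unramified:
`E ⊆ F`, and the ring of integers of `F` is an unramified algebra (of finite type and formally
unramified) over that of `E`. As the rings of integers are complete discrete valuation rings, this
means that a uniformizer of `E` is a uniformizer of `F` and the residue field extension is
separable. -/
def IsUnramifiedExtension {K : Type*} [NontriviallyNormedField K] [IsUltrametricDist K]
    {L : Type*} [Field L] [Algebra K L] [Algebra.IsAlgebraic K L]
    (E F : IntermediateField K L) : Prop :=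
  ∃ h : E ≤ F,
    (Subring.inclusion (integersOf_mono h)).FiniteType ∧
    (Subring.inclusion (integersOf_mono h)).FormallyUnramified

end

end LocalArboreal

/-! Write `N` for the extension of the absolute value of `K` to `L` and suppose `|c| > 1`. Then `c`
dominates: every point `β` of level at least `1`, i.e. every iterated preimage of `a`, satisfies
`N β ^ ℓ = |c|` (`abv_pow_eq_of_iterate_succ`). From `x ^ ℓ - y ^ ℓ = ∏ (x - ζ * y)` one gets, by
induction on the level, that every point `β` of level `n + 1` has a point `β'` of level `n` with
`N (β - β') ≤ |c| ^ (1 / ℓ ^ (n + 1))` (`exists_iterate_abv_sub_le`).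

Let `β` be of level `n + 1`, and let `E` be a field containing the points of level `n`, among them
`β ^ ℓ - c`. The conjugates of `β` over `E` are among the `ζ * β` with `ζ ^ ℓ = 1`, at distance
`N (1 - ζ) * |c| ^ (1 / ℓ)` from `β`. If this exceeds `|c| ^ (1 / ℓ ^ (n + 1))` for all `ζ ≠ 1`,
then Krasner's argument shows that `β` lies in `E` (`mem_range_of_abv_sub_lt`,
`mem_of_iterPreimage_succ`). This applies to all higher levels too, and the tower stops at `K_n`
(`levelInfty_eq_level`). In the tame case `N (1 - ζ) = 1`, and `n = 1` will do. In the wild case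
`N (1 - ζ) ^ (p - 1) = |p|`, and the comparison of the two distances is precisely `v c < ν_n`
(`log_abv_pow_mul`).

If the two distances are equal, then the comparison is strict at level `n + 1`, so the tower stops
at `K_(n+1)`. For `β` of level `n + 1`, dividing `β - β'` by an element of `K_n` of the critical
absolute value gives an integral element `y` which generates the same extension as `β`, and whose
conjugates have mutual distances `1`. By Lagrange interpolation at the conjugates, the
integers of the extension are generated by `y`, and the derivative of its minimal polynomial at `y`
is a unit, so the extension is unramified (`isUnramifiedExtension_sup_adjoin_singleton`). As `K_(n+1)` is reached by
finitely many such steps, it is unramified over `K_n`. -/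

namespace LocalArboreal

open Polynomial

/-! ### Roots of unity -/

section RootsOfUnity

variable {L : Type*} [Field L] {N : AbsoluteValue L ℝ} {ℓ : ℕ} {ζ ξ : L}

theorem abv_eq_one_of_pow_eq_one (hℓ : ℓ ≠ 0) (hζ : ζ ^ ℓ = 1) : N ζ = 1 := by
  have h : N ζ ^ ℓ = 1 := by rw [← map_pow, hζ, map_one]
  exact (pow_eq_one_iff_of_nonneg (N.nonneg _) hℓ).1 h

theorem abv_sub_le (hN : IsNonarchimedean N) (x y : L) : N (x - y) ≤ max (N x) (N y) := by
  rw [sub_eq_add_neg, ← N.map_neg y]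
  exact hN _ _

theorem prod_abv_one_sub_pow (hℓ : ℓ ≠ 0) (hζ : IsPrimitiveRoot ζ ℓ) :
    ∏ k ∈ Finset.range (ℓ - 1), N (1 - ζ ^ (k + 1)) = N (ℓ : L) := by
  obtain ⟨m, rfl⟩ := Nat.exists_eq_succ_of_ne_zero hℓ
  rw [← map_prod, Nat.succ_sub_one, hζ.prod_one_sub_pow_eq_order]
  simp

theorem abv_one_sub_eq_one (hN : IsNonarchimedean N) (hℓ : ℓ ≠ 0) (hNℓ : N (ℓ : L) = 1)
    (hζ : IsPrimitiveRoot ζ ℓ) (hξ : ξ ^ ℓ = 1) (hξ1 : ξ ≠ 1) : N (1 - ξ) = 1 := by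
  have hle : ∀ η : L, η ^ ℓ = 1 → N (1 - η) ≤ 1 := fun η hη =>
    (abv_sub_le hN _ _).trans (by simp [abv_eq_one_of_pow_eq_one hℓ hη])
  have : NeZero ℓ := ⟨hℓ⟩
  obtain ⟨i, hi, rfl⟩ := hζ.eq_pow_of_pow_eq_one hξ
  have hi0 : i ≠ 0 := by rintro rfl; simp at hξ1
  have hmem : i - 1 ∈ Finset.range (ℓ - 1) := Finset.mem_range.2 (by omega)
  have hprod := prod_abv_one_sub_pow (N := N) hℓ hζ
  rw [hNℓ, ← Finset.mul_prod_erase _ _ hmem, Nat.sub_add_cancel (Nat.pos_of_ne_zero hi0)] at hprod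
  have hpow : ∀ k, (ζ ^ k) ^ ℓ = 1 := fun k => by rw [pow_right_comm, hζ.pow_eq_one, one_pow]
  have hrest := Finset.prod_le_one (s := (Finset.range (ℓ - 1)).erase (i - 1))
    (f := fun k => N (1 - ζ ^ (k + 1))) (fun k _ => N.nonneg _) (fun k _ => hle _ (hpow _))
  refine le_antisymm (hle _ hξ) ?_
  rw [← hprod]
  exact mul_le_of_le_one_right (N.nonneg _) hrest

theorem abv_one_sub_pow_le (hN : IsNonarchimedean N) (hℓ : ℓ ≠ 0) (hζ : ζ ^ ℓ = 1) (j : ℕ) :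
    N (1 - ζ ^ j) ≤ N (1 - ζ) := by
  induction j with
  | zero => simp
  | succ j ih =>
    have h : 1 - ζ ^ (j + 1) = (1 - ζ ^ j) + ζ ^ j * (1 - ζ) := by ring
    rw [h]
    refine (hN _ _).trans (max_le ih ?_)
    rw [map_mul, map_pow, abv_eq_one_of_pow_eq_one hℓ hζ, one_pow, one_mul]

theorem isPrimitiveRoot_of_pow_prime_eq_one {p : ℕ} (hp : p.Prime) (hζ : ζ ^ p = 1)
    (hζ1 : ζ ≠ 1) : IsPrimitiveRoot ζ p := by
  have := orderOf_eq_prime_iff (p := p) (x := ζ) (hp := ⟨hp⟩) |>.2 ⟨hζ, hζ1⟩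
  exact this ▸ IsPrimitiveRoot.orderOf ζ

theorem abv_one_sub_eq_of_prime {p : ℕ} (hN : IsNonarchimedean N) (hp : p.Prime)
    (hζ : ζ ^ p = 1) (hζ1 : ζ ≠ 1) (hξ : ξ ^ p = 1) (hξ1 : ξ ≠ 1) : N (1 - ζ) = N (1 - ξ) := by
  have : NeZero p := ⟨hp.ne_zero⟩
  have key : ∀ ζ ξ : L, ζ ^ p = 1 → ζ ≠ 1 → ξ ^ p = 1 → N (1 - ξ) ≤ N (1 - ζ) := by
    intro ζ ξ hζ hζ1 hξ
    obtain ⟨i, -, rfl⟩ :=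
      (isPrimitiveRoot_of_pow_prime_eq_one hp hζ hζ1).eq_pow_of_pow_eq_one hξ
    exact abv_one_sub_pow_le hN hp.ne_zero hζ i
  exact le_antisymm (key _ _ hξ hξ1 hζ) (key _ _ hζ hζ1 hξ)

theorem abv_one_sub_pow_of_prime {p : ℕ} (hN : IsNonarchimedean N) (hp : p.Prime)
    (hζ : ζ ^ p = 1) (hζ1 : ζ ≠ 1) : N (1 - ζ) ^ (p - 1) = N (p : L) := by
  have h := isPrimitiveRoot_of_pow_prime_eq_one hp hζ hζ1
  rw [← prod_abv_one_sub_pow hp.ne_zero h]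
  rw [Finset.prod_congr rfl (g := fun _ => N (1 - ζ)), Finset.prod_const, Finset.card_range]
  intro k hk
  refine abv_one_sub_eq_of_prime hN hp (by rw [pow_right_comm, hζ, one_pow])
    (h.pow_ne_one_of_pos_of_lt k.succ_ne_zero ?_) hζ hζ1
  have := Finset.mem_range.1 hk
  omega

end RootsOfUnity

/-! ### Absolute values of iterated preimages -/

section Preimages

variable {L : Type*} [Field L] {N : AbsoluteValue L ℝ} {ℓ : ℕ} {ζ a c β : L}

/-- Since `|c| > 1`, the term `c` dominates `z` whenever `|z| ≤ |c|^(1/ℓ)`. -/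
theorem abv_pow_eq_of_pow_sub (hN : IsNonarchimedean N) (hℓ : 2 ≤ ℓ) (hc : 1 < N c)
    (h : N (β ^ ℓ - c) ^ ℓ ≤ N c) : N β ^ ℓ = N c := by
  have hlt : N (β ^ ℓ - c) < N c := by
    by_contra! hge
    have h1 : N c ^ ℓ ≤ N c := (pow_le_pow_left₀ (N.nonneg _) hge ℓ).trans h
    have h2 : N c ^ 1 < N c ^ ℓ := pow_lt_pow_right₀ hc (by omega)
    rw [pow_one] at h2
    exact absurd h1 (not_le.2 h2)
  have := hN.add_eq_right_of_lt hlt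
  rwa [sub_add_cancel, map_pow] at this

theorem abv_pow_le_of_iterate (hN : IsNonarchimedean N) (hℓ : 2 ≤ ℓ) (hc : 1 < N c)
    (ha : N a ^ ℓ ≤ N c) (k : ℕ) :
    ∀ β, (fun z : L => z ^ ℓ - c)^[k] β = a → N β ^ ℓ ≤ N c := by
  induction k with
  | zero => rintro β rfl; exact ha
  | succ k ih =>
    intro β hβ
    exact (abv_pow_eq_of_pow_sub hN hℓ hc (ih _ hβ)).le

theorem abv_pow_eq_of_iterate_succ (hN : IsNonarchimedean N) (hℓ : 2 ≤ ℓ) (hc : 1 < N c)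
    (ha : N a ^ ℓ ≤ N c) {k : ℕ} (hβ : (fun z : L => z ^ ℓ - c)^[k + 1] β = a) :
    N β ^ ℓ = N c :=
  abv_pow_eq_of_pow_sub hN hℓ hc (abv_pow_le_of_iterate hN hℓ hc ha k _ hβ)

/-- As `x ^ ℓ - y ^ ℓ` is the product of the `x - ζ * y`, one of these factors is small. -/
theorem exists_abv_sub_mul_pow_le (hℓ : 0 < ℓ) (hζ : IsPrimitiveRoot ζ ℓ) (x y : L) :
    ∃ ξ : L, ξ ^ ℓ = 1 ∧ N (x - ξ * y) ^ ℓ ≤ N (x ^ ℓ - y ^ ℓ) := by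
  obtain ⟨ξ, hξ, hmin⟩ := Finset.exists_min_image (nthRootsFinset ℓ (1 : L))
    (fun ξ => N (x - ξ * y)) ⟨1, by rw [mem_nthRootsFinset hℓ, one_pow]⟩
  refine ⟨ξ, (mem_nthRootsFinset hℓ _).1 hξ, ?_⟩
  rw [hζ.pow_sub_pow_eq_prod_sub_mul x y hℓ, map_prod]
  calc N (x - ξ * y) ^ ℓ = ∏ _η ∈ nthRootsFinset ℓ (1 : L), N (x - ξ * y) := by
        rw [Finset.prod_const, hζ.card_nthRootsFinset]
    _ ≤ _ := Finset.prod_le_prod (fun _ _ => N.nonneg _) hmin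

/-- Every point of level `k + 1` has a point of level `k` at distance at most `|c|^(1/ℓ^(k+1))`:
pulling back a pair of points by `f` takes an `ℓ`th root of their distance, for a suitable choice
of preimages. -/
theorem exists_iterate_abv_sub_le (hN : IsNonarchimedean N) (hℓ : 2 ≤ ℓ) (hc : 1 < N c)
    (ha : N a ^ ℓ ≤ N c) (hζ : IsPrimitiveRoot ζ ℓ) [IsAlgClosed L] (k : ℕ) :
    ∀ β, (fun z : L => z ^ ℓ - c)^[k + 1] β = a →
      ∃ β', (fun z : L => z ^ ℓ - c)^[k] β' = a ∧ N (β - β') ^ ℓ ^ (k + 1) ≤ N c := by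
  induction k with
  | zero =>
    intro β hβ
    refine ⟨a, rfl, ?_⟩
    have hβ' := abv_pow_eq_of_iterate_succ hN hℓ hc ha hβ
    rw [zero_add, pow_one]
    rcases le_max_iff.1 (abv_sub_le hN β a) with h | h
    · exact (pow_le_pow_left₀ (N.nonneg _) h ℓ).trans hβ'.le
    · exact (pow_le_pow_left₀ (N.nonneg _) h ℓ).trans ha
  | succ k ih =>
    intro β hβ
    obtain ⟨α', hα', hle⟩ := ih _ hβ
    obtain ⟨γ, hγ⟩ := IsAlgClosed.exists_pow_nat_eq (α' + c) (n := ℓ) (by omega)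
    obtain ⟨ξ, hξ, hβγ⟩ := exists_abv_sub_mul_pow_le (N := N) (by omega) hζ β γ
    refine ⟨ξ * γ, ?_, ?_⟩
    · rw [Function.iterate_succ_apply]
      simpa only [mul_pow, hξ, one_mul, hγ, add_sub_cancel_right] using hα'
    · rw [pow_succ' ℓ (k + 1), pow_mul]
      refine (pow_le_pow_left₀ (pow_nonneg (N.nonneg _) _) hβγ _).trans ?_
      rwa [hγ, ← sub_sub, sub_right_comm]

end Preimages

/-! ### Conjugates -/

section Conjugates

variable {E L : Type*} [Field E] [Field L] [Algebra E L]

theorem exists_algEquiv_of_mem_rootSet_minpoly [Normal E L] {y t : L}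
    (ht : t ∈ (minpoly E y).rootSet L) : ∃ σ : L ≃ₐ[E] L, σ y = t :=
  minpoly.exists_algEquiv_of_root' (Normal.isIntegral inferInstance y).isAlgebraic
    (Polynomial.aeval_eq_zero_of_mem_rootSet ht)

theorem mem_range_of_forall_algEquiv [Normal E L] {y : L} (hy : IsSeparable E y)
    (h : ∀ σ : L ≃ₐ[E] L, σ y = y) : y ∈ (algebraMap E L).range := by
  rw [← minpoly.natDegree_eq_one_iff]
  have hsplit : ((minpoly E y).map (algebraMap E L)).Splits := Normal.splits inferInstance y
  have hcard := card_rootSet_eq_natDegree hy hsplit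
  have hsub : Fintype.card ((minpoly E y).rootSet L) ≤ 1 := by
    rw [Fintype.card_le_one_iff]
    rintro ⟨s, hs⟩ ⟨t, ht⟩
    obtain ⟨σ, rfl⟩ := exists_algEquiv_of_mem_rootSet_minpoly hs
    obtain ⟨τ, rfl⟩ := exists_algEquiv_of_mem_rootSet_minpoly ht
    simp [h]
  have hpos := minpoly.natDegree_pos (Normal.isIntegral (F := E) inferInstance y)
  omega

theorem isSeparable_of_pow_sub {ℓ : ℕ} {β : L} {c : E} (hℓ : (ℓ : E) ≠ 0)
    (hβ0 : β ≠ 0) (hβ : β ^ ℓ = algebraMap E L c) : IsSeparable E β := by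
  have hc : c ≠ 0 := by
    rintro rfl
    exact hβ0 (eq_zero_of_pow_eq_zero (hβ.trans (map_zero _)))
  exact (separable_X_pow_sub_C c hℓ hc).of_dvd (minpoly.dvd _ _ (by simp [hβ]))

/-- Krasner's argument for the polynomial `X ^ ℓ - c`: the conjugates of `β` are among the `ζ * β`
with `ζ ^ ℓ = 1`, and one with `ζ ≠ 1` would be too far from `β`, since `β` and its conjugates have
the same distance to `β'`. -/
theorem mem_range_of_abv_sub_lt [Normal E L] {N : AbsoluteValue L ℝ} (hN : IsNonarchimedean N)
    (hinv : ∀ (σ : L ≃ₐ[E] L) x, N (σ x) = N x) {ℓ : ℕ} {β : L} {c b' : E} (hℓ : (ℓ : E) ≠ 0)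
    (hβ0 : β ≠ 0) (hβ : β ^ ℓ = algebraMap E L c)
    (hlt : ∀ ζ : L, ζ ^ ℓ = 1 → ζ ≠ 1 → N (β - algebraMap E L b') < N (1 - ζ) * N β) :
    β ∈ (algebraMap E L).range := by
  refine mem_range_of_forall_algEquiv (isSeparable_of_pow_sub hℓ hβ0 hβ) fun σ => ?_
  by_contra hne
  have hσ : (σ β / β) ^ ℓ = 1 := by
    rw [div_pow, ← map_pow, hβ, AlgEquiv.commutes, ← hβ, div_self (pow_ne_zero _ hβ0)]
  have h1 := hlt _ hσ (by rwa [Ne, div_eq_one_iff_eq hβ0])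
  rw [← map_mul, sub_mul, one_mul, div_mul_cancel₀ _ hβ0] at h1
  have h2 : β - σ β = (β - algebraMap E L b') - σ (β - algebraMap E L b') := by
    rw [map_sub, AlgEquiv.commutes]; ring
  have h3 := abv_sub_le hN (β - algebraMap E L b') (σ (β - algebraMap E L b'))
  rw [← h2, hinv, max_self] at h3
  exact absurd h1 (not_lt.2 h3)

end Conjugates

/-! ### Monogenic unramified extensions -/

/-- The Kähler differentials of `φ` are generated by `dy`, and `M'(y) dy = d(M(y)) = 0`. -/
theorem unramified_of_isUnit_eval_derivative {R S : Type*} [CommRing R] [CommRing S] (φ : R →+* S)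
    (y : S) (hgen : ∀ x, ∃ Q : R[X], Q.eval₂ φ y = x) (M : R[X]) (hM : M.eval₂ φ y = 0)
    (hunit : IsUnit (M.derivative.eval₂ φ y)) : φ.FiniteType ∧ φ.FormallyUnramified := by
  algebraize [φ]
  have hgen' : ∀ x : S, ∃ Q : R[X], aeval y Q = x := hgen
  constructor
  · refine ⟨⟨{y}, ?_⟩⟩
    rw [Finset.coe_singleton, eq_top_iff]
    rintro x -
    obtain ⟨Q, rfl⟩ := hgen' x
    exact aeval_mem_adjoin_singleton R y
  · refine ⟨?_⟩
    have hDy : KaehlerDifferential.D R S y = 0 := by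
      have h := (KaehlerDifferential.D R S).map_aeval M y
      have h0 : aeval y M = 0 := hM
      rw [h0, map_zero] at h
      exact (hunit.smul_eq_zero (x := KaehlerDifferential.D R S y)).1 h.symm
    rw [← Submodule.subsingleton_iff S, ← subsingleton_iff_bot_eq_top,
      ← KaehlerDifferential.span_range_derivation, eq_comm, Submodule.span_eq_bot]
    rintro _ ⟨x, rfl⟩
    obtain ⟨Q, rfl⟩ := hgen' x
    rw [Derivation.map_aeval, hDy, smul_zero]

section Spectral

variable {K : Type*} [NontriviallyNormedField K] [IsUltrametricDist K]
  {L : Type*} [Field L] [Algebra K L] [Algebra.IsAlgebraic K L]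

theorem isUnramifiedExtension_refl (E : IntermediateField K L) : IsUnramifiedExtension E E := by
  have h : Function.Surjective (Subring.inclusion (integersOf_mono (le_refl E))) :=
    fun x => ⟨x, rfl⟩
  exact ⟨le_rfl, RingHom.FiniteType.of_surjective _ h, RingHom.FormallyUnramified.of_surjective h⟩

theorem IsUnramifiedExtension.trans {E F M : IntermediateField K L}
    (h : IsUnramifiedExtension E F) (h' : IsUnramifiedExtension F M) :
    IsUnramifiedExtension E M := by
  obtain ⟨h, h1, h2⟩ := h
  obtain ⟨h', h1', h2'⟩ := h'
  exact ⟨h.trans h', h1'.comp h1, h2.comp h2'⟩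

theorem X_sub_C_mem_lifts {A : Subring L} {t : L} (ht : t ∈ A) : X - C t ∈ lifts A.subtype := by
  rw [sub_eq_add_neg, ← C_neg]
  exact add_mem (X_mem_lifts _) (C_mem_lifts A.subtype ⟨-t, neg_mem ht⟩)

theorem C_mem_lifts_of_mem {A : Subring L} {t : L} (ht : t ∈ A) : C t ∈ lifts A.subtype :=
  C_mem_lifts A.subtype ⟨t, ht⟩

theorem nodal_mem_lifts {A : Subring L} {s : Finset L} (hs : ∀ t ∈ s, t ∈ A) :
    Lagrange.nodal s id ∈ lifts A.subtype :=
  prod_mem fun t ht => X_sub_C_mem_lifts (hs t ht)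

/-- If the differences of distinct nodes are units, then Lagrange interpolation preserves
integrality. -/
theorem interpolate_mem_lifts {A : Subring L} [DecidableEq L] {s : Finset L} (hs : ∀ t ∈ s, t ∈ A)
    (hinv : ∀ t ∈ s, ∀ u ∈ s, t ≠ u → (t - u)⁻¹ ∈ A) {r : L → L} (hr : ∀ t ∈ s, r t ∈ A) :
    Lagrange.interpolate s id r ∈ lifts A.subtype := by
  rw [Lagrange.interpolate_apply]
  refine sum_mem fun t ht => mul_mem (C_mem_lifts_of_mem (hr t ht)) (prod_mem fun u hu => ?_)
  obtain ⟨hne, hu⟩ := Finset.mem_erase.1 hu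
  exact mul_mem (C_mem_lifts_of_mem (hinv t ht u hu hne.symm)) (X_sub_C_mem_lifts (hs u hu))

theorem map_mem_lifts_integersOf {E : IntermediateField K L} {q : E[X]}
    (hq : q.map (algebraMap E L) ∈ lifts (integersOf (⊤ : IntermediateField K L)).subtype) :
    q.map (algebraMap E L) ∈ lifts (integersOf E).subtype := by
  rw [lifts_iff_coeff_lifts] at hq ⊢
  intro n
  obtain ⟨z, hz⟩ := hq n
  refine ⟨⟨(q.map (algebraMap E L)).coeff n, ?_, ?_⟩, rfl⟩
  · rw [coeff_map]; exact (q.coeff n).2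
  · rw [← hz]; exact z.2.2

variable [CompleteSpace K]

variable (K L) in
/-- The unique extension of the absolute value of the complete field `K` to `L`. -/
noncomputable def spectralAbv : AbsoluteValue L ℝ where
  toFun := spectralNorm K L
  map_mul' := map_mul (spectralMulAlgNorm K L)
  nonneg' := spectralNorm_nonneg
  eq_zero' x := ⟨fun h => eq_zero_of_map_spectralNorm_eq_zero h (Algebra.IsAlgebraic.isAlgebraic x),
    fun h => h ▸ spectralNorm_zero⟩
  add_le' _ _ :=
    (isNonarchimedean_spectralNorm (K := K) (L := L)).add_le (fun x => spectralNorm_nonneg x)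

theorem isNonarchimedean_spectralAbv : IsNonarchimedean (spectralAbv K L) :=
  isNonarchimedean_spectralNorm

theorem spectralAbv_algebraMap (x : K) : spectralAbv K L (algebraMap K L x) = ‖x‖ :=
  spectralNorm_extends x

theorem spectralAbv_algEquiv (E : IntermediateField K L) (σ : L ≃ₐ[E] L) (x : L) :
    spectralAbv K L (σ x) = spectralAbv K L x :=
  (spectralNorm_eq_of_equiv (σ.restrictScalars K) x).symm

theorem isUnit_integersOf {E : IntermediateField K L} {x : integersOf E}
    (hx : spectralAbv K L (x : L) = 1) : IsUnit x := by
  have hx0 : (x : L) ≠ 0 := by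
    intro h
    rw [h, map_zero] at hx
    exact zero_ne_one hx
  refine IsUnit.of_mul_eq_one ⟨(x : L)⁻¹, E.inv_mem x.2.1, ?_⟩ (Subtype.ext (mul_inv_cancel₀ hx0))
  exact (map_inv₀ (spectralAbv K L) (x : L)).trans_le (by rw [hx, inv_one])

/-- If the conjugates of the integral element `y` over `E` have mutual distances `1`, then
`E(y) / E` is unramified. Indeed, by Lagrange interpolation at the conjugates of `y`, the integers
of `E(y)` are generated by `y`, and the derivative of the minimal polynomial at `y` is a unit. -/
theorem isUnramifiedExtension_sup_adjoin_singleton (E : IntermediateField K L) [Normal E L] {y : L}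
    (hy : spectralAbv K L y ≤ 1) (hsep : IsSeparable E y)
    (hconj : ∀ σ : L ≃ₐ[E] L, σ y ≠ y → spectralAbv K L (y - σ y) = 1) :
    IsUnramifiedExtension E (E ⊔ IntermediateField.adjoin K {y}) := by
  classical
  set F := E ⊔ IntermediateField.adjoin K {y} with hF
  have hF' : F = (IntermediateField.adjoin E {y}).restrictScalars K :=
    (IntermediateField.restrictScalars_adjoin_eq_sup K E {y}).symm
  have hyF : y ∈ F := (le_sup_right : _ ≤ F) (IntermediateField.mem_adjoin_simple_self K y)
  have hint : IsIntegral E y := Normal.isIntegral inferInstance y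
  set μ := minpoly E y with hμ
  have hsplit : (μ.map (algebraMap E L)).Splits := Normal.splits inferInstance y
  set s : Finset L := (μ.rootSet L).toFinset with hs
  have hcard : s.card = μ.natDegree := by
    rw [hs, Set.toFinset_card]; exact card_rootSet_eq_natDegree hsep hsplit
  have hconj_s : ∀ t ∈ s, ∃ σ : L ≃ₐ[E] L, σ y = t := fun t ht =>
    exists_algEquiv_of_mem_rootSet_minpoly (Set.mem_toFinset.1 ht)
  have hys : y ∈ s := Set.mem_toFinset.2
    (mem_rootSet.2 ⟨minpoly.ne_zero hint, minpoly.aeval E y⟩)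
  have hdist : ∀ t ∈ s, ∀ u ∈ s, t ≠ u → spectralAbv K L (t - u) = 1 := by
    intro t ht u hu hne
    obtain ⟨σ, rfl⟩ := hconj_s t ht
    obtain ⟨τ, rfl⟩ := hconj_s u hu
    have h : σ y - τ y = σ (y - (τ.trans σ.symm) y) := by simp
    rw [h, spectralAbv_algEquiv]
    refine hconj _ fun h' => hne ?_
    simpa using (congrArg σ h').symm
  set A := integersOf (⊤ : IntermediateField K L) with hA
  have hmemA : ∀ x : L, spectralAbv K L x ≤ 1 → x ∈ A := fun x hx => ⟨trivial, hx⟩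
  have hsA : ∀ t ∈ s, t ∈ A := by
    intro t ht
    obtain ⟨σ, rfl⟩ := hconj_s t ht
    exact hmemA _ (by rwa [spectralAbv_algEquiv])
  have hμs : μ.map (algebraMap E L) = Lagrange.nodal s id := by
    have h1 := hsplit.eq_prod_roots_of_monic ((minpoly.monic hint).map _)
    have h2 : (μ.map (algebraMap E L)).roots.Nodup := nodup_roots (Polynomial.Separable.map hsep)
    rw [h1, Lagrange.nodal, hs]
    simp only [rootSet_def, Finset.toFinset_coe, id]
    rw [Finset.prod, Multiset.toFinset_val, aroots_def, h2.dedup]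
  obtain ⟨M, hM⟩ := (mem_lifts _).1 (map_mem_lifts_integersOf (hμs ▸ nodal_mem_lifts hsA))
  rw [hμs] at hM
  have heval : ∀ (Q : (integersOf E)[X]),
      ((Q.eval₂ (Subring.inclusion (integersOf_mono (le_sup_left : E ≤ F)))
        (⟨y, hyF, hy⟩ : integersOf F) : integersOf F) : L)
        = (Q.map (integersOf E).subtype).eval y := by
    intro Q
    rw [eval_map]
    exact hom_eval₂ Q _ (integersOf F).subtype _
  refine ⟨le_sup_left, unramified_of_isUnit_eval_derivative _ ⟨y, hyF, hy⟩ ?_ M ?_ ?_⟩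
  · rintro ⟨x, hxF, hx⟩
    have hxy : x ∈ IntermediateField.adjoin E {y} := by
      rw [hF'] at hxF; exact hxF
    obtain ⟨q, hqd, hq⟩ : ∃ q : E[X], q.degree < μ.degree ∧ aeval y q = x := by
      rw [← IntermediateField.mem_toSubalgebra,
        IntermediateField.adjoin_simple_toSubalgebra_of_isAlgebraic hint.isAlgebraic,
        Algebra.adjoin_singleton_eq_range_aeval] at hxy
      obtain ⟨q, hq⟩ := hxy
      refine ⟨q %ₘ μ, degree_modByMonic_lt _ (minpoly.monic hint), ?_⟩
      rw [← hq]
      exact aeval_modByMonic_eq_self_of_root (minpoly.aeval E y)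
    have hqA : q.map (algebraMap E L) ∈ lifts A.subtype := by
      rw [Lagrange.eq_interpolate (f := q.map (algebraMap E L)) (s := s) (v := id)
        Function.injective_id.injOn]
      · refine interpolate_mem_lifts hsA (fun t ht u hu hne => hmemA _ ?_) fun t ht => hmemA _ ?_
        · rw [map_inv₀, hdist t ht u hu hne, inv_one]
        · obtain ⟨σ, rfl⟩ := hconj_s t ht
          have h : aeval (σ y) q = σ x := (aeval_algHom_apply σ.toAlgHom y q).trans (by rw [hq]; rfl)
          rw [id, eval_map_algebraMap, h, spectralAbv_algEquiv]
          exact hx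
      · rw [degree_map, hcard, ← degree_eq_natDegree (minpoly.ne_zero hint)]
        exact hqd
    obtain ⟨Q, hQ⟩ := (mem_lifts _).1 (map_mem_lifts_integersOf hqA)
    refine ⟨Q, Subtype.ext ?_⟩
    rw [heval, hQ, eval_map_algebraMap, hq]
  · refine Subtype.ext ?_
    rw [heval, hM, Lagrange.eval_nodal]
    exact Finset.prod_eq_zero hys (sub_self _)
  · refine isUnit_integersOf ?_
    rw [heval, ← derivative_map, hM]
    have := Lagrange.eval_nodal_derivative_eval_node_eq (v := (id : L → L)) hys
    rw [id] at this
    rw [this, Lagrange.eval_nodal, map_prod]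
    refine Finset.prod_eq_one fun t ht => ?_
    obtain ⟨hne, ht⟩ := Finset.mem_erase.1 ht
    exact hdist y hys t ht hne.symm

end Spectral

/-! ### The tower of preimage fields -/

section Tower

theorem mem_iterPreimage {K L : Type*} [Field K] [Field L] [Algebra K L] {ℓ n : ℕ} {a c : K}
    {β : L} : β ∈ iterPreimage L (X ^ ℓ - C c) a n ↔
      (fun z : L => z ^ ℓ - algebraMap K L c)^[n] β = algebraMap K L a := by
  have h : (fun z : L => aeval z (X ^ ℓ - C c)) = fun z : L => z ^ ℓ - algebraMap K L c := by
    funext z; simp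
  rw [iterPreimage, h]
  rfl

theorem mem_iterPreimage_succ {K L : Type*} [Field K] [Field L] [Algebra K L] {ℓ n : ℕ} {a c : K}
    {β : L} : β ∈ iterPreimage L (X ^ ℓ - C c) a (n + 1) ↔
      β ^ ℓ - algebraMap K L c ∈ iterPreimage L (X ^ ℓ - C c) a n := by
  rw [mem_iterPreimage, mem_iterPreimage, Function.iterate_succ_apply]

theorem iterPreimage_subset_level {K L : Type*} [Field K] [Field L] [Algebra K L] (f : K[X]) (a : K)
    (n : ℕ) : iterPreimage L f a n ⊆ level L f a n :=
  IntermediateField.subset_adjoin K _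

theorem finite_iterPreimage {K : Type*} [Field K] (L : Type*) [Field L] [Algebra K L] {ℓ : ℕ}
    (hℓ : 0 < ℓ) (a c : K) (n : ℕ) : (iterPreimage L (X ^ ℓ - C c) a n).Finite := by
  classical
  induction n with
  | zero =>
    refine (Set.finite_singleton (algebraMap K L a)).subset fun β hβ => ?_
    exact mem_iterPreimage.1 hβ
  | succ n ih =>
    refine (ih.biUnion fun α _ => (nthRoots ℓ (α + algebraMap K L c)).toFinset.finite_toSet).subset
      fun β hβ => Set.mem_biUnion (mem_iterPreimage_succ.1 hβ) ?_
    rw [Finset.mem_coe, Multiset.mem_toFinset, mem_nthRoots hℓ, sub_add_cancel]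

theorem level_mono {K : Type*} [Field K] (L : Type*) [Field L] [Algebra K L] [IsAlgClosed L] {ℓ : ℕ}
    (hℓ : 0 < ℓ) (a c : K) : Monotone (level L (X ^ ℓ - C c) a) := by
  refine monotone_nat_of_le_succ fun n => IntermediateField.adjoin_le_iff.2 fun α hα => ?_
  obtain ⟨β, hβ⟩ := IsAlgClosed.exists_pow_nat_eq (α + algebraMap K L c) hℓ
  have hα' : α = β ^ ℓ - algebraMap K L c := by rw [hβ, add_sub_cancel_right]
  rw [hα'] at hα ⊢
  exact sub_mem (pow_mem (iterPreimage_subset_level _ _ _ (mem_iterPreimage_succ.2 hα)) _)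
    (algebraMap_mem _ c)

variable {K : Type*} [NontriviallyNormedField K] [IsUltrametricDist K] [CompleteSpace K]
  {L : Type*} [Field L] [Algebra K L] [Algebra.IsAlgebraic K L] [IsAlgClosed L]
  {ℓ : ℕ} {a c : K} {ζ : L}

/-- A point of level `m + 1` is so close to one of level `m` that Krasner's argument puts it in
any field containing the points of level `m`. The distance `|c|^(1/ℓ^(m+1))` is to be compared with
`|1 - ξ| * |c|^(1/ℓ)`; the assumption is this comparison raised to the power `ℓ^(m+1)`. -/
theorem mem_of_iterPreimage_succ (hℓ : 2 ≤ ℓ) (hζ : IsPrimitiveRoot ζ ℓ) (hℓK : (ℓ : K) ≠ 0)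
    (hc : 1 < ‖c‖) (ha : ‖a‖ ^ ℓ ≤ ‖c‖) {m : ℕ}
    (hlt : ∀ ξ : L, ξ ^ ℓ = 1 → ξ ≠ 1 →
      ‖c‖ < spectralAbv K L (1 - ξ) ^ ℓ ^ (m + 1) * ‖c‖ ^ ℓ ^ m)
    {E : IntermediateField K L} (hE : level L (X ^ ℓ - C c) a m ≤ E) {β : L}
    (hβ : β ∈ iterPreimage L (X ^ ℓ - C c) a (m + 1)) : β ∈ E := by
  have hN := isNonarchimedean_spectralAbv (K := K) (L := L)
  have hc' : 1 < spectralAbv K L (algebraMap K L c) := by rwa [spectralAbv_algebraMap]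
  have ha' : spectralAbv K L (algebraMap K L a) ^ ℓ ≤ spectralAbv K L (algebraMap K L c) := by
    rwa [spectralAbv_algebraMap, spectralAbv_algebraMap]
  obtain ⟨β', hβ', hclose⟩ := exists_iterate_abv_sub_le hN hℓ hc' ha' hζ m β (mem_iterPreimage.1 hβ)
  have hNβ := abv_pow_eq_of_iterate_succ hN hℓ hc' ha' (mem_iterPreimage.1 hβ)
  have hβ'E : β' ∈ E := hE (iterPreimage_subset_level _ _ _ (mem_iterPreimage.2 hβ'))
  have hαE : β ^ ℓ - algebraMap K L c ∈ E :=
    hE (iterPreimage_subset_level _ _ _ (mem_iterPreimage_succ.1 hβ))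
  have hβE : β ^ ℓ ∈ E := by
    simpa using add_mem hαE (algebraMap_mem E c)
  have hβ0 : β ≠ 0 := by
    rintro rfl
    rw [map_zero, zero_pow (by omega)] at hNβ
    exact absurd hc' (by rw [← hNβ]; norm_num)
  have : IsAlgClosure E L := ⟨inferInstance, Algebra.IsAlgebraic.tower_top (K := K) E⟩
  have hnormal : Normal E L := IsAlgClosure.normal E L
  have hℓE : (ℓ : E) ≠ 0 := by
    rw [← map_natCast (algebraMap K E)]
    exact (_root_.map_ne_zero _).2 hℓK
  obtain ⟨⟨b, hb⟩, rfl⟩ := mem_range_of_abv_sub_lt hN (spectralAbv_algEquiv E) (c := ⟨β ^ ℓ, hβE⟩)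
    (b' := ⟨β', hβ'E⟩) hℓE hβ0 rfl (fun ξ hξ hξ1 => by
      by_contra! hle
      have h1 := (pow_le_pow_left₀ (mul_nonneg (AbsoluteValue.nonneg _ _)
        (AbsoluteValue.nonneg _ _)) hle (ℓ ^ (m + 1))).trans hclose
      rw [mul_pow, pow_succ' ℓ m, pow_mul (spectralAbv K L β), hNβ, spectralAbv_algebraMap,
        ← pow_succ'] at h1
      exact absurd (hlt ξ hξ hξ1) (not_lt.2 h1))
  exact hb

/-- The comparison of distances persists on higher levels. -/
theorem lt_pow_mul_pow_of_le {w x : ℝ} (hℓ : 1 ≤ ℓ) (hx : 1 < x) {n m : ℕ} (hnm : n ≤ m)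
    (h : x < w ^ ℓ ^ (n + 1) * x ^ ℓ ^ n) : x < w ^ ℓ ^ (m + 1) * x ^ ℓ ^ m := by
  obtain ⟨k, rfl⟩ := Nat.exists_eq_add_of_le hnm
  rw [show n + k + 1 = (n + 1) + k by omega, pow_add ℓ (n + 1) k, pow_add ℓ n k,
    pow_mul, pow_mul, ← mul_pow]
  have hk : ℓ ^ k ≠ 0 := pow_ne_zero _ (by omega)
  exact h.trans_le (le_self_pow₀ (hx.le.trans h.le) hk)

theorem levelInfty_eq_level (hℓ : 2 ≤ ℓ) (hζ : IsPrimitiveRoot ζ ℓ) (hℓK : (ℓ : K) ≠ 0)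
    (hc : 1 < ‖c‖) (ha : ‖a‖ ^ ℓ ≤ ‖c‖) {n : ℕ} (hn : 1 ≤ n)
    (hlt : ∀ ξ : L, ξ ^ ℓ = 1 → ξ ≠ 1 →
      ‖c‖ < spectralAbv K L (1 - ξ) ^ ℓ ^ (n + 1) * ‖c‖ ^ ℓ ^ n) :
    levelInfty L (X ^ ℓ - C c) a = level L (X ^ ℓ - C c) a n := by
  refine le_antisymm (iSup₂_le fun m _ => ?_) (le_iSup₂_of_le n hn le_rfl)
  rcases le_total m n with h | h
  · exact level_mono L (by omega) a c h
  · induction m, h using Nat.le_induction with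
    | base => exact le_rfl
    | succ m hm ih =>
      exact IntermediateField.adjoin_le_iff.2 fun β hβ =>
        mem_of_iterPreimage_succ hℓ hζ hℓK hc ha
          (fun ξ hξ hξ1 => lt_pow_mul_pow_of_le (by omega) hc hm (hlt ξ hξ hξ1))
          (ih (by omega)) hβ

/-- In the boundary case, a point `β` of level `n + 1` and a nearby point `β'` of level `n` are at
most as far apart as `β` and its conjugates. Hence `(β - β') / (ζ * β' - β')` is integral, with
conjugates at mutual distances `1`. -/
theorem isUnramifiedExtension_sup_adjoin_of_iterPreimage_succ (hℓ : 2 ≤ ℓ)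
    (hζ : IsPrimitiveRoot ζ ℓ) (hℓK : (ℓ : K) ≠ 0) (hc : 1 < ‖c‖) (ha : ‖a‖ ^ ℓ ≤ ‖c‖) {n : ℕ}
    (hn : 1 ≤ n)
    (heq : ∀ ξ : L, ξ ^ ℓ = 1 → ξ ≠ 1 →
      spectralAbv K L (1 - ξ) ^ ℓ ^ (n + 1) * ‖c‖ ^ ℓ ^ n = ‖c‖)
    {E : IntermediateField K L} (hE : level L (X ^ ℓ - C c) a n ≤ E) {β : L}
    (hβ : β ∈ iterPreimage L (X ^ ℓ - C c) a (n + 1)) :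
    IsUnramifiedExtension E (E ⊔ IntermediateField.adjoin K {β}) := by
  have hN := isNonarchimedean_spectralAbv (K := K) (L := L)
  have hc' : 1 < spectralAbv K L (algebraMap K L c) := by rwa [spectralAbv_algebraMap]
  have ha' : spectralAbv K L (algebraMap K L a) ^ ℓ ≤ spectralAbv K L (algebraMap K L c) := by
    rwa [spectralAbv_algebraMap, spectralAbv_algebraMap]
  obtain ⟨β', hβ', hclose⟩ := exists_iterate_abv_sub_le hN hℓ hc' ha' hζ n β (mem_iterPreimage.1 hβ)
  have hNβ := abv_pow_eq_of_iterate_succ hN hℓ hc' ha' (mem_iterPreimage.1 hβ)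
  obtain ⟨k, rfl⟩ := Nat.exists_eq_add_of_le' hn
  have hNβ' := abv_pow_eq_of_iterate_succ hN hℓ hc' ha' hβ'
  rw [← mem_iterPreimage] at hβ'
  rw [spectralAbv_algebraMap] at hNβ hNβ' hclose
  have hβ'E : β' ∈ E := hE (iterPreimage_subset_level _ _ _ hβ')
  have hζβ'E : ζ * β' ∈ E := by
    refine hE (iterPreimage_subset_level _ _ _ (mem_iterPreimage_succ.2 ?_))
    rw [mul_pow, hζ.pow_eq_one, one_mul]
    exact mem_iterPreimage_succ.1 hβ'
  have hβE : β ^ ℓ ∈ E := by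
    simpa using add_mem (hE (iterPreimage_subset_level _ _ _ (mem_iterPreimage_succ.1 hβ)))
      (algebraMap_mem E c)
  have hβ0 : β ≠ 0 := by
    rintro rfl
    rw [map_zero, zero_pow (by omega)] at hNβ
    exact absurd hc (by rw [← hNβ]; norm_num)
  have : IsAlgClosure E L := ⟨inferInstance, Algebra.IsAlgebraic.tower_top (K := K) E⟩
  have hnormal : Normal E L := IsAlgClosure.normal E L
  have hℓE : (ℓ : E) ≠ 0 := by
    rw [← map_natCast (algebraMap K E)]
    exact (_root_.map_ne_zero _).2 hℓK
  set u := ζ * β' - β' with hu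
  have huE : u ∈ E := sub_mem hζβ'E hβ'E
  have hpow0 : ℓ ^ (k + 1 + 1) ≠ 0 := pow_ne_zero _ (by omega)
  have hdist : ∀ ξ γ : L, ξ ^ ℓ = 1 → ξ ≠ 1 → spectralAbv K L γ ^ ℓ = ‖c‖ →
      spectralAbv K L (ξ * γ - γ) ^ ℓ ^ (k + 1 + 1) = ‖c‖ := by
    intro ξ γ hξ hξ1 hγ
    rw [← heq ξ hξ hξ1, (spectralAbv K L).map_sub, show γ - ξ * γ = (1 - ξ) * γ by ring, map_mul,
      mul_pow, pow_succ' ℓ (k + 1), pow_mul (spectralAbv K L γ), hγ]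
  have hNu := hdist ζ β' hζ.pow_eq_one (hζ.ne_one (by omega)) hNβ'
  have hu0 : u ≠ 0 := by
    intro h
    rw [← hu, h, map_zero, zero_pow hpow0] at hNu
    exact absurd hc (by rw [← hNu]; norm_num)
  set y := (β - β') / u with hy
  have hβy : β = β' + u * y := by rw [hy, mul_div_cancel₀ _ hu0]; ring
  have hadj : E ⊔ IntermediateField.adjoin K {β} = E ⊔ IntermediateField.adjoin K {y} := by
    apply le_antisymm
    · refine sup_le le_sup_left (IntermediateField.adjoin_simple_le_iff.2 ?_)
      have hyF : y ∈ E ⊔ IntermediateField.adjoin K {y} :=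
        (le_sup_right : _ ≤ E ⊔ _) (IntermediateField.mem_adjoin_simple_self K y)
      have hEF : E ≤ E ⊔ IntermediateField.adjoin K {y} := le_sup_left
      rw [hβy]
      exact add_mem (hEF hβ'E) (mul_mem (hEF huE) hyF)
    · refine sup_le le_sup_left (IntermediateField.adjoin_simple_le_iff.2 ?_)
      have hβF : β ∈ E ⊔ IntermediateField.adjoin K {β} :=
        (le_sup_right : _ ≤ E ⊔ _) (IntermediateField.mem_adjoin_simple_self K β)
      have hEF : E ≤ E ⊔ IntermediateField.adjoin K {β} := le_sup_left
      exact div_mem (sub_mem hβF (hEF hβ'E)) (hEF huE)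
  rw [hadj]
  apply isUnramifiedExtension_sup_adjoin_singleton
  · rw [← pow_le_one_iff_of_nonneg (AbsoluteValue.nonneg _ _) hpow0, hy, map_div₀, div_pow, hNu]
    exact div_le_one_of_le₀ hclose (norm_nonneg c)
  · have hsepβ : IsSeparable E β := isSeparable_of_pow_sub (c := ⟨β ^ ℓ, hβE⟩) hℓE hβ0 rfl
    have hsepE : ∀ x ∈ E, IsSeparable E x := fun x hx => isSeparable_algebraMap (⟨x, hx⟩ : E)
    have h := Field.isSeparable_mul (Field.isSeparable_sub hsepβ (hsepE _ hβ'E))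
      (hsepE _ (inv_mem huE))
    rwa [← div_eq_mul_inv] at h
  · intro σ hσ
    have hσE : ∀ x ∈ E, σ x = x := fun x hx => σ.commutes ⟨x, hx⟩
    have hσy : σ y = (σ β - β') / u := by
      rw [hy, map_div₀, map_sub, hσE _ hβ'E, hσE _ huE]
    have hne : σ β / β ≠ 1 := by
      rw [Ne, div_eq_one_iff_eq hβ0]
      intro h
      exact hσ (by rw [hσy, h])
    have hroot : (σ β / β) ^ ℓ = 1 := by
      rw [div_pow, ← map_pow, hσE _ hβE, div_self (pow_ne_zero _ hβ0)]
    have h := hdist _ β hroot hne hNβ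
    rw [div_mul_cancel₀ _ hβ0] at h
    rw [← pow_eq_one_iff_of_nonneg (AbsoluteValue.nonneg _ _) hpow0, (spectralAbv K L).map_sub, hσy,
      hy, ← sub_div, sub_sub_sub_cancel_right, map_div₀, div_pow, h, hNu]
    exact div_self (by linarith)

theorem isUnramifiedExtension_level_succ (hℓ : 2 ≤ ℓ) (hζ : IsPrimitiveRoot ζ ℓ)
    (hℓK : (ℓ : K) ≠ 0) (hc : 1 < ‖c‖) (ha : ‖a‖ ^ ℓ ≤ ‖c‖) {n : ℕ} (hn : 1 ≤ n)
    (heq : ∀ ξ : L, ξ ^ ℓ = 1 → ξ ≠ 1 →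
      spectralAbv K L (1 - ξ) ^ ℓ ^ (n + 1) * ‖c‖ ^ ℓ ^ n = ‖c‖) :
    IsUnramifiedExtension (level L (X ^ ℓ - C c) a n) (level L (X ^ ℓ - C c) a (n + 1)) := by
  have key : ∀ S : Set L, S.Finite → S ⊆ iterPreimage L (X ^ ℓ - C c) a (n + 1) →
      IsUnramifiedExtension (level L (X ^ ℓ - C c) a n)
        (level L (X ^ ℓ - C c) a n ⊔ IntermediateField.adjoin K S) := by
    intro S hS
    induction S, hS using Set.Finite.induction_on with
    | empty =>
      intro _
      rw [IntermediateField.adjoin_empty, sup_bot_eq]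
      exact isUnramifiedExtension_refl _
    | @insert β S _ _ ih =>
      intro hsub
      obtain ⟨hβ, hS⟩ := Set.insert_subset_iff.1 hsub
      rw [Set.insert_eq, Set.union_comm, IntermediateField.adjoin_union, ← sup_assoc]
      exact (ih hS).trans (isUnramifiedExtension_sup_adjoin_of_iterPreimage_succ hℓ hζ hℓK hc ha hn
        heq le_sup_left hβ)
  have h := key _ (finite_iterPreimage L (by omega) a c (n + 1)) subset_rfl
  rwa [← level, sup_eq_right.2 (level_mono L (by omega) a c n.le_succ)] at h

end Tower

/-! ### Valuations -/

section Valuation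

variable {K : Type*} [NormedField K]

theorem one_lt_norm_of_v_neg {c : K} (h : v c < 0) : 1 < ‖c‖ :=
  (Real.log_pos_iff (norm_nonneg c)).1 (by rw [v] at h; linarith)

theorem norm_pow_le_of_div_le_v {ℓ : ℕ} (hℓ : 0 < ℓ) {a c : K} (hc : c ≠ 0)
    (ha : a = 0 ∨ v c / ℓ ≤ v a) : ‖a‖ ^ ℓ ≤ ‖c‖ := by
  rcases eq_or_ne a 0 with rfl | ha0
  · rw [norm_zero, zero_pow hℓ.ne']; exact norm_nonneg c
  · have h := ha.resolve_left ha0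
    rw [v, v, div_le_iff₀ (Nat.cast_pos.2 hℓ)] at h
    rw [← Real.log_le_log_iff (pow_pos (norm_pos_iff.2 ha0) _) (norm_pos_iff.2 hc), Real.log_pow]
    linarith

/-- With `w = |1 - ξ|`, where `ξ ≠ 1` is an `ℓ`th root of unity, one has
`ν_n = ℓ^(n+1) / (ℓ^n - 1) * log w`. -/
theorem sub_one_mul_nu {ℓ n : ℕ} (hℓ : 2 ≤ ℓ) (hn : 1 ≤ n) {w : ℝ} (hw : w ^ (ℓ - 1) = ‖(ℓ : K)‖) :
    ((ℓ : ℝ) ^ n - 1) * nu K ℓ n = (ℓ : ℝ) ^ (n + 1) * Real.log w := by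
  have h1 : (1 : ℝ) < ℓ := by exact_mod_cast hℓ
  have h2 : (1 : ℝ) < (ℓ : ℝ) ^ n := one_lt_pow₀ h1 (by omega)
  rw [nu, v, ← hw, Real.log_pow, Nat.cast_sub (by omega), Nat.cast_one]
  have h3 : (ℓ : ℝ) - 1 ≠ 0 := by linarith
  have h4 : (ℓ : ℝ) ^ n - 1 ≠ 0 := by linarith
  field_simp

/-- The logarithmic form of the comparison of distances. -/
theorem log_abv_pow_mul {ℓ n : ℕ} (hℓ : 2 ≤ ℓ) (hn : 1 ≤ n) {w : ℝ} (hw0 : 0 < w)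
    (hw : w ^ (ℓ - 1) = ‖(ℓ : K)‖) {c : K} (hc : c ≠ 0) :
    Real.log (w ^ ℓ ^ (n + 1) * ‖c‖ ^ ℓ ^ n) =
      Real.log ‖c‖ + ((ℓ : ℝ) ^ n - 1) * (nu K ℓ n - v c) := by
  rw [Real.log_mul (by positivity) (pow_ne_zero _ (norm_ne_zero_iff.2 hc)), Real.log_pow,
    Real.log_pow, mul_sub, sub_one_mul_nu hℓ hn hw, v]
  push_cast
  ring

variable [IsUltrametricDist K] {p : ℕ} [CharP (residueField K) p]

theorem norm_natCast_lt_one_iff {m : ℕ} : ‖(m : K)‖ < 1 ↔ p ∣ m := by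
  rw [← CharP.cast_eq_zero_iff (residueField K) p m,
    ← map_natCast (IsLocalRing.residue (ringOfIntegers K)), IsLocalRing.residue_eq_zero_iff,
    ← ValuationSubring.coe_mem_nonunits_iff, ValuationSubring.mem_nonunits_iff_or]
  change _ ↔ (m : K) = 0 ∨ ¬ ‖(m : K)⁻¹‖ ≤ 1
  rcases eq_or_ne (m : K) 0 with h | h
  · simp [h]
  · rw [norm_inv, inv_le_one₀ (norm_pos_iff.2 h), not_le, or_iff_right h]

end Valuation

end LocalArboreal

open LocalArboreal Polynomial in
theorem theorem4p3
    -- `K` is complete with respect to a discrete valuation `v`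
    (K : Type*) [NontriviallyNormedField K] [IsUltrametricDist K] [CompleteSpace K]
    [IsDiscreteValuationRing (ringOfIntegers K)]
    -- `L` is an algebraic closure of `K`, and `p` is the characteristic of the residue field
    (L : Type*) [Field L] [Algebra K L] [IsAlgClosure K L] [Algebra.IsAlgebraic K L]
    (p : ℕ) [CharP (residueField K) p]
    (ℓ : ℕ) (hℓ : 2 ≤ ℓ) (c : K) (hc : c ≠ 0)
    -- `v(a) ≥ v(c) / ℓ`, where `v(0) = ∞`
    (a : K) (ha : a = 0 ∨ v c / ℓ ≤ v a) :
    -- tame case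
    (¬ p ∣ ℓ → v c < 0 →
      levelInfty L (X ^ ℓ - C c) a = level L (X ^ ℓ - C c) a 1) ∧
    -- wild case
    (ℓ = p → IsFiniteExtensionOfPadic p K → ∀ n : ℕ, 1 ≤ n →
      (v c < nu K ℓ n →
        levelInfty L (X ^ ℓ - C c) a = level L (X ^ ℓ - C c) a n) ∧
      (v c = nu K ℓ n →
        levelInfty L (X ^ ℓ - C c) a = level L (X ^ ℓ - C c) a (n + 1) ∧
        IsUnramifiedExtension (level L (X ^ ℓ - C c) a n) (level L (X ^ ℓ - C c) a (n + 1)))) := by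
  have : IsAlgClosed L := IsAlgClosure.isAlgClosed K
  have hN := isNonarchimedean_spectralAbv (K := K) (L := L)
  have ha' := norm_pow_le_of_div_le_v (by omega) hc ha
  have hprim : (ℓ : K) ≠ 0 → ∃ ζ : L, IsPrimitiveRoot ζ ℓ := by
    intro h
    have : NeZero (ℓ : L) := ⟨by
      rw [← map_natCast (algebraMap K L)]
      exact (_root_.map_ne_zero _).2 h⟩
    exact HasEnoughRootsOfUnity.exists_primitiveRoot L ℓ
  have hNℓ : spectralAbv K L (ℓ : L) = ‖(ℓ : K)‖ := by
    rw [← map_natCast (algebraMap K L), spectralAbv_algebraMap]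
  constructor
  · intro hp hvc
    have hc1 := one_lt_norm_of_v_neg hvc
    have hℓ1 : ‖(ℓ : K)‖ = 1 := le_antisymm (IsUltrametricDist.norm_natCast_le_one K ℓ)
      (not_lt.1 (mt norm_natCast_lt_one_iff.1 hp))
    have hℓK : (ℓ : K) ≠ 0 := norm_ne_zero_iff.1 (by rw [hℓ1]; exact one_ne_zero)
    obtain ⟨ζ, hζ⟩ := hprim hℓK
    refine levelInfty_eq_level hℓ hζ hℓK hc1 ha' le_rfl fun ξ hξ hξ1 => ?_
    rw [abv_one_sub_eq_one hN (by omega) (hNℓ.trans hℓ1) hζ hξ hξ1, one_pow, one_mul, pow_one]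
    exact lt_self_pow₀ hc1 (by omega)
  · rintro rfl ⟨hp, hQ, -⟩ n hn
    have : CharZero K := charZero_of_injective_algebraMap (algebraMap ℚ_[ℓ] K).injective
    have hℓK : (ℓ : K) ≠ 0 := Nat.cast_ne_zero.2 (by omega)
    obtain ⟨ζ, hζ⟩ := hprim hℓK
    have hℓ1 : ‖(ℓ : K)‖ < 1 := norm_natCast_lt_one_iff.2 dvd_rfl
    have hw : ∀ ξ : L, ξ ^ ℓ = 1 → ξ ≠ 1 → spectralAbv K L (1 - ξ) ^ (ℓ - 1) = ‖(ℓ : K)‖ :=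
      fun ξ hξ hξ1 => (abv_one_sub_pow_of_prime hN hp.out hξ hξ1).trans hNℓ
    have hw0 : ∀ ξ : L, ξ ≠ 1 → 0 < spectralAbv K L (1 - ξ) := fun ξ hξ1 =>
      AbsoluteValue.pos _ (sub_ne_zero.2 hξ1.symm)
    have hpow : (0 : ℝ) < (ℓ : ℝ) ^ n - 1 :=
      sub_pos.2 (one_lt_pow₀ (by exact_mod_cast hℓ) (by omega))
    have hcpos : 0 < ‖c‖ := norm_pos_iff.2 hc
    have hlog := fun (ξ : L) hξ hξ1 => log_abv_pow_mul hℓ hn (hw0 ξ hξ1) (hw ξ hξ hξ1) hc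
    have hnu : nu K ℓ n < 0 := by
      have hℓ2 : (1 : ℝ) < ℓ := by exact_mod_cast hℓ
      have h1 := mul_pos hpow (sub_pos.2 hℓ2)
      have h2 := Real.log_neg (norm_pos_iff.2 hℓK) hℓ1
      rw [nu, v, neg_mul_neg]
      exact mul_neg_of_pos_of_neg (by positivity) h2
    constructor
    · intro hvc
      refine levelInfty_eq_level hℓ hζ hℓK (one_lt_norm_of_v_neg (hvc.trans hnu)) ha' hn
        fun ξ hξ hξ1 => ?_
      rw [← Real.log_lt_log_iff hcpos
        (mul_pos (pow_pos (hw0 ξ hξ1) _) (pow_pos hcpos _)), hlog ξ hξ hξ1]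
      exact lt_add_of_pos_right _ (mul_pos hpow (sub_pos.2 hvc))
    · intro hvc
      have hc1 := one_lt_norm_of_v_neg (hvc.trans_lt hnu)
      have heq : ∀ ξ : L, ξ ^ ℓ = 1 → ξ ≠ 1 →
          spectralAbv K L (1 - ξ) ^ ℓ ^ (n + 1) * ‖c‖ ^ ℓ ^ n = ‖c‖ := fun ξ hξ hξ1 => by
        refine Real.log_injOn_pos (mul_pos (pow_pos (hw0 ξ hξ1) _) (pow_pos hcpos _)) hcpos ?_
        rw [hlog ξ hξ hξ1, hvc, sub_self, mul_zero, add_zero]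
      refine ⟨levelInfty_eq_level hℓ hζ hℓK hc1 ha' (by omega) fun ξ hξ hξ1 => ?_,
        isUnramifiedExtension_level_succ hℓ hζ hℓK hc1 ha' hn heq⟩
      -- raising the equality on level `n` to the power `ℓ` gives `‖c‖ ^ ℓ > ‖c‖` on level `n + 1`
      calc ‖c‖ < ‖c‖ ^ ℓ := lt_self_pow₀ hc1 (by omega)
        _ = (spectralAbv K L (1 - ξ) ^ ℓ ^ (n + 1) * ‖c‖ ^ ℓ ^ n) ^ ℓ := by rw [heq ξ hξ hξ1]
        _ = _ := by rw [mul_pow, ← pow_mul, ← pow_mul, ← pow_succ, ← pow_succ]
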